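/- Let $F$ be an Archimedean vector lattice (a real vector lattice with $\inf_{n\ge 1}\frac1n f=0$ for every $f\in F_+$). For $A\subset F$ write $A_+=\{f\in A: f\ge 0\}$. Elements $e,f\in F$ are disjoint if $|e|\wedge|f|=0$, a set is disjoint if its distinct elements are mutually disjoint, and $A^d$ is the set of all $f\in F$ that are disjoint from every element of $A$. An ideal of $F$ is a linear subspace $H$ such that $|f|\le|h|$ and $h\in H$ imply $f\in H$; it is a projection band if $F=H+H^d$. An ideal $E\subset H$ is order dense in $H$ if for every $0<h\in H$ there is $e\in E$ with $0<e\le h$; it is countably generated if it is the smallest ideal of $F$ containing some countable set. A set $G\subset F$ is order bounded in $A\subset F$ if $G\subset[a,b]$ for some $a,b\in A$. **Theorem 3.10.** For an ideal $H\subset F$ the following are equivalent: (i) $H$ is a projection band; (ii) every $G\subset H_+$ which is order bounded in $F$ is order bounded in $H$; (iii) every disjoint $G\subset H_+$ which is order bounded in $F$ is order bounded in $H$; (iv) there is an ideal $E\subset H$ which is order dense in $H$ and such that every disjoint $G\subset E_+$ which is order bounded in $F$ is order bounded in $H$. Moreover, if $H$ contains a countably generated ideal $E$ which is order dense in $H$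 and such that every countable disjoint $G\subset E_+$ which is order bounded in $F$ is order bounded in $H$, then $H$ is a projection band. -/

import Mathlib

namespace VectorLattice

section Definitions

variable {F : Type*} [AddCommGroup F] [Lattice F] [Module ℝ F]

/-- A vector lattice is *Archimedean* if `⋀ₙ (1/n) f = 0` for every `f ≥ 0`
(here `n` runs over the positive integers `k + 1`). -/
def IsArchimedean (F : Type*) [AddCommGroup F] [Lattice F] [Module ℝ F] : Prop :=
  ∀ f : F, 0 ≤ f → IsGLB (Set.range fun k : ℕ => (1 / ((k : ℝ) + 1)) • f) 0

/-- A linear subspace is an *ideal* if it is solid: `|f| ≤ |g|` and `g ∈ H` imply `f ∈ H`. -/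
def IsIdeal (H : Submodule ℝ F) : Prop :=
  LatticeOrderedAddCommGroup.IsSolid (H : Set F)

/-- The positive part `G₊ = G ∩ F₊` of a set. -/
def pos (G : Set F) : Set F := G ∩ Set.Ici 0

/-- Two elements are (vector-lattice) *disjoint* if `|e| ∧ |f| = 0`. -/
def Disj (e f : F) : Prop := |e| ⊓ |f| = 0

/-- A set is *disjoint* if its distinct elements are mutually disjoint. -/
def IsDisjointSet (G : Set F) : Prop := G.Pairwise Disj

/-- The disjoint complement `Gᵈ`. -/
def disjointComplement (G : Set F) : Set F := {f | ∀ g ∈ G, Disj f g}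

/-- An ideal `H` is a *projection band* if `F = H + Hᵈ`. -/
def IsProjectionBand (H : Submodule ℝ F) : Prop :=
  IsIdeal H ∧ ∀ f : F, ∃ h ∈ H, ∃ g ∈ disjointComplement (H : Set F), f = h + g

/-- `G` is *order bounded in* `A` if it lies in an order interval with end points in `A`. -/
def OrderBoundedIn (A G : Set F) : Prop :=
  ∃ a ∈ A, ∃ b ∈ A, G ⊆ Set.Icc a b

/-- `E` is an *order dense* subspace of `H`: `E ⊆ H`, and `E` meets `(0, h]` for every
nonzero positive `h ∈ H`. -/
def IsOrderDenseIn (E H : Submodule ℝ F) : Prop :=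
  E ≤ H ∧ ∀ h ∈ H, 0 < h → ∃ e ∈ E, 0 < e ∧ e ≤ h

/-- The ideal `I(G)` generated by `G`: the intersection of all ideals that contain `G`. -/
def generatedIdeal (G : Set F) : Submodule ℝ F :=
  sInf {J : Submodule ℝ F | IsIdeal J ∧ G ⊆ (J : Set F)}

/-- An ideal is *countably generated* if it is generated by a countable set. -/
def IsCountablyGenerated (E : Submodule ℝ F) : Prop :=
  ∃ G : Set F, G.Countable ∧ E = generatedIdeal G

end Definitions

end VectorLattice

namespace VectorLattice

section Sequences

variable {F : Type*} [AddCommGroup F]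

/-! The substance is to project `f ≥ 0` onto `H` knowing only that disjoint bounded sets have bounds
in `H`. Take `x` in `E` with `x 0 = 0` and `3 • x n ≤ x (n + 1)`, and cut `f` into shells, roughly
where `x n < 3f` and `f < x (n + 1)`. Shells lie below `f`, and non-consecutive ones are disjoint,
so some `h ∈ H` bounds them all (`exists_shell_le`). Induction from `x 0 = 0` gives `(x n - f)⁺ ⊓ f
≤ h`. Thus `x n < 2f` where `h < f`; if `x n` eventually dominates `3 ^ n • b`, the Archimedean
property forces `(f - h)⁺ ⊓ b = 0` (`posPart_sub_inf_eq_zero`).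

Condition (iv) uses one such sequence per member of a maximal disjoint subset of `E₊`; the countable
case uses a single one, built from partial sums of generators. -/

/-- The sequence `0, 3 b₁, 9 b₂, 27 b₃, …`. -/
def geomSeq (b : ℕ → F) (n : ℕ) : F := if n = 0 then 0 else 3 ^ n • b n

theorem geomSeq_mem [Module ℝ F] {E : Submodule ℝ F} {b : ℕ → F} (hb : ∀ n, b n ∈ E) (n : ℕ) :
    geomSeq b n ∈ E := by
  unfold geomSeq; split_ifs
  · exact E.zero_mem
  · exact nsmul_mem (hb n) _

end Sequences

section Lattice

variable {F : Type*} [AddCommGroup F] [Lattice F]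

theorem inf_eq_zero_of_le {a b c d : F} (ha : 0 ≤ a) (hb : 0 ≤ b) (hac : a ≤ c) (hbd : b ≤ d)
    (h : c ⊓ d = 0) : a ⊓ b = 0 :=
  le_antisymm ((inf_le_inf hac hbd).trans h.le) (le_inf ha hb)

theorem Disj.symm {a b : F} (h : Disj a b) : Disj b a := by
  unfold Disj at *; rwa [inf_comm]

/-- The part of `f` living where `f < y` and `x < 3 f`. -/
def shell (f x y : F) : F := (y - f)⁺ ⊓ f ⊓ (3 • f - x)⁺

theorem shell_nonneg {f x y : F} (hf : 0 ≤ f) : 0 ≤ shell f x y :=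
  le_inf (le_inf (posPart_nonneg _) hf) (posPart_nonneg _)

theorem shell_le_left {f x y : F} : shell f x y ≤ f := inf_le_left.trans inf_le_right

theorem abs_smul_le [Module ℝ F] [IsOrderedModule ℝ F] (r : ℝ) (a : F) : |r • a| ≤ |r| • |a| := by
  have key : ∀ (s : ℝ) (b : F), s • b ≤ |s| • |b| := fun s b => by
    rcases le_total 0 s with hs | hs
    · rw [abs_of_nonneg hs]; exact smul_le_smul_of_nonneg_left (le_abs_self b) hs
    · rw [abs_of_nonpos hs, ← neg_smul_neg]
      exact smul_le_smul_of_nonneg_left (neg_le_abs b) (neg_nonneg.2 hs)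
  refine abs_le'.2 ⟨key r a, ?_⟩
  simpa using key r (-a)

end Lattice

section Lemmas

variable {F : Type*} [AddCommGroup F] [Lattice F] [IsOrderedAddMonoid F]

theorem inf_add_le_of_nonneg {a b c : F} (ha : 0 ≤ a) (hb : 0 ≤ b) (hc : 0 ≤ c) :
    a ⊓ (b + c) ≤ a ⊓ b + a ⊓ c := by
  rw [inf_add, add_inf, add_inf]
  refine le_inf (le_inf ?_ ?_) (le_inf ?_ ?_)
  · exact inf_le_left.trans (le_add_of_nonneg_left ha)
  · exact inf_le_left.trans (le_add_of_nonneg_right hc)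
  · exact inf_le_left.trans (le_add_of_nonneg_left hb)
  · exact inf_le_right

theorem inf_add_eq_zero {a b c : F} (ha : 0 ≤ a) (hb : 0 ≤ b) (hc : 0 ≤ c)
    (h₁ : a ⊓ b = 0) (h₂ : a ⊓ c = 0) : a ⊓ (b + c) = 0 :=
  le_antisymm ((inf_add_le_of_nonneg ha hb hc).trans (by simp [h₁, h₂]))
    (le_inf ha (add_nonneg hb hc))

theorem inf_nsmul_eq_zero {a b : F} (ha : 0 ≤ a) (hb : 0 ≤ b) (h : a ⊓ b = 0) (n : ℕ) :
    a ⊓ n • b = 0 := by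
  induction n with
  | zero => simpa using ha
  | succ n ih => rw [succ_nsmul]; exact inf_add_eq_zero ha (nsmul_nonneg hb n) hb ih h

theorem disj_iff_of_nonneg {a b : F} (ha : 0 ≤ a) (hb : 0 ≤ b) : Disj a b ↔ a ⊓ b = 0 := by
  rw [Disj, abs_of_nonneg ha, abs_of_nonneg hb]

theorem posPart_inf_posPart_neg (a : F) : a⁺ ⊓ (-a)⁺ = 0 := by
  rw [posPart_neg]; exact posPart_inf_negPart_eq_zero a

theorem le_nsmul_self {a : F} (ha : 0 ≤ a) {n : ℕ} (hn : n ≠ 0) : a ≤ n • a := by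
  simpa using nsmul_le_nsmul_left ha (Nat.one_le_iff_ne_zero.2 hn)

/-! ### Shells and truncations -/

theorem shell_le_right {f x y : F} (hf : 0 ≤ f) (hy : 0 ≤ y) : shell f x y ≤ y :=
  inf_le_left.trans <| inf_le_left.trans <| sup_le (sub_le_self _ hf) hy

/-- The first shell lives where `f < y`, the second where `x' < 3f`; `3y ≤ x'` excludes both at
once. -/
theorem shell_inf_shell {f x y x' y' : F} (hf : 0 ≤ f) (h : 3 • y ≤ x') :
    shell f x y ⊓ shell f x' y' = 0 := by
  have hneg : (y - f)⁺ ⊓ 3 • (-(y - f))⁺ = 0 :=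
    inf_nsmul_eq_zero (posPart_nonneg _) (posPart_nonneg _) (posPart_inf_posPart_neg _) _
  refine inf_eq_zero_of_le (shell_nonneg hf) (shell_nonneg hf)
    (inf_le_left.trans inf_le_left) (inf_le_right.trans ?_) hneg
  refine sup_le ?_ (nsmul_nonneg (posPart_nonneg _) _)
  calc 3 • f - x' ≤ 3 • f - 3 • y := sub_le_sub_left h _
    _ = 3 • (-(y - f)) := by rw [← nsmul_sub, neg_sub]
    _ ≤ _ := nsmul_le_nsmul_right (le_posPart _) _

/-- Where `x < 2f`, `3f - x` exceeds `f`; elsewhere `x - f` already does. -/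
theorem posPart_sub_inf_le_sup_shell {f x y : F} :
    (y - f)⁺ ⊓ f ≤ ((x - f)⁺ ⊓ f) ⊔ shell f x y := by
  let _ : DistribLattice F := AddCommGroup.toDistribLattice F
  have hle : f ≤ (x - f)⁺ ⊔ (3 • f - x)⁺ := by
    calc f ≤ f + |x - 2 • f| := le_add_of_nonneg_right (abs_nonneg _)
      _ = (x - f) ⊔ (3 • f - x) := by
        rw [abs, add_sup]; congr 1 <;> abel
      _ ≤ _ := sup_le_sup (le_posPart _) (le_posPart _)
  calc (y - f)⁺ ⊓ f = ((y - f)⁺ ⊓ f) ⊓ (((x - f)⁺ ⊓ f) ⊔ (3 • f - x)⁺) := by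
        refine (inf_eq_left.2 ?_).symm
        rw [sup_inf_right]
        exact inf_le_right.trans (le_inf hle le_sup_left)
    _ = (((y - f)⁺ ⊓ f) ⊓ ((x - f)⁺ ⊓ f)) ⊔ shell f x y := inf_sup_left _ _ _
    _ ≤ _ := sup_le_sup_right inf_le_right _

/-- A common upper bound of all shells of a fast growing sequence `x` that starts at `0`
dominates the truncations `(x n - f)⁺ ⊓ f`. -/
theorem posPart_sub_inf_le_of_shell_le {f h : F} {x : ℕ → F} (hf : 0 ≤ f) (h0 : x 0 = 0)
    (hh : ∀ n, shell f (x n) (x (n + 1)) ≤ h) (n : ℕ) : (x n - f)⁺ ⊓ f ≤ h := by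
  have hpos : 0 ≤ h := (shell_nonneg hf).trans (hh 0)
  induction n with
  | zero =>
    refine inf_le_left.trans ?_
    rw [h0, zero_sub, posPart_of_nonpos (neg_nonpos.2 hf)]
    exact hpos
  | succ n ih => exact (posPart_sub_inf_le_sup_shell).trans (sup_le ih (hh n))

/-- Where `u > 0` one has `h < f`, so `hz` forces `z - f < f` there; hence `N • u ≤ z < 2f`. -/
theorem nsmul_le_of_posPart_sub_inf_le {f h u z : F} {N : ℕ} (hf : 0 ≤ f) (hu : 0 ≤ u)
    (huh : u ≤ (f - h)⁺) (huz : N • u ≤ z) (hz : (z - f)⁺ ⊓ f ≤ h) : N • u ≤ 2 • f := by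
  have h₁ : u ≤ (2 • f - N • u)⁺ := by
    calc u ≤ (f - h)⁺ := huh
      _ ≤ (f - ((N • u - f) ⊓ f))⁺ := by
        refine posPart_mono (sub_le_sub_left (le_trans ?_ hz) _)
        exact inf_le_inf_right _ ((sub_le_sub_right huz _).trans (le_posPart _))
      _ = (2 • f - N • u)⁺ := by
        rw [sub_inf, sub_self, ← posPart_def, posPart_eq_self.2 (posPart_nonneg _)]
        congr 1; abel
  have h₂ : (N • u - 2 • f)⁺ ⊓ N • u = 0 := by
    refine inf_nsmul_eq_zero (posPart_nonneg _) hu ?_ _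
    refine inf_eq_zero_of_le (posPart_nonneg _) hu le_rfl h₁ ?_
    rw [← neg_sub (N • u)]; exact posPart_inf_posPart_neg _
  have h₃ : (N • u - 2 • f)⁺ ≤ N • u :=
    sup_le (sub_le_self _ (nsmul_nonneg hf _)) (nsmul_nonneg hu _)
  rw [inf_eq_left.2 h₃, posPart_eq_zero] at h₂
  exact sub_nonpos.1 h₂

theorem IsIdeal.mem_of_le [Module ℝ F] {H : Submodule ℝ F} (hH : IsIdeal H) {a b : F} (ha : 0 ≤ a)
    (hab : a ≤ b) (hb : b ∈ H) : a ∈ H :=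
  hH hb (by rwa [abs_of_nonneg ha, abs_of_nonneg (ha.trans hab)])

theorem IsIdeal.abs_mem [Module ℝ F] {H : Submodule ℝ F} (hH : IsIdeal H) {a : F} (ha : a ∈ H) :
    |a| ∈ H :=
  hH ha (abs_abs a).le

/-- The elements disjoint from `w`, as a submodule. -/
def disjointSubmodule [Module ℝ F] [IsOrderedModule ℝ F] (w : F) : Submodule ℝ F where
  carrier := {a | Disj w a}
  zero_mem' := by simp [Disj]
  add_mem' {a b} ha hb :=
    inf_eq_zero_of_le (abs_nonneg _) (abs_nonneg _) le_rfl (abs_add_le a b)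
      (inf_add_eq_zero (abs_nonneg _) (abs_nonneg _) (abs_nonneg _) ha hb)
  smul_mem' r a ha := by
    obtain ⟨n, hn⟩ := exists_nat_ge |r|
    refine inf_eq_zero_of_le (abs_nonneg _) (abs_nonneg _) le_rfl (d := n • |a|) ?_
      (inf_nsmul_eq_zero (abs_nonneg _) (abs_nonneg _) ha n)
    refine (abs_smul_le r a).trans ?_
    rw [← Nat.cast_smul_eq_nsmul ℝ]
    exact smul_le_smul_of_nonneg_right hn (abs_nonneg _)

theorem isIdeal_disjointSubmodule [Module ℝ F] [IsOrderedModule ℝ F] (w : F) :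
    IsIdeal (disjointSubmodule w) := fun _ ha _ hba =>
  inf_eq_zero_of_le (abs_nonneg _) (abs_nonneg _) le_rfl hba ha

theorem IsArchimedean.eq_zero_of_nsmul_le [Module ℝ F] [IsOrderedModule ℝ F]
    (hF : IsArchimedean F) {u g : F} (hu : 0 ≤ u) (hg : 0 ≤ g)
    (h : ∀ k : ℕ, ∃ N ≥ k, N • u ≤ g) : u = 0 := by
  refine le_antisymm ((hF g hg).2 ?_) hu
  rintro _ ⟨k, rfl⟩
  obtain ⟨N, hN, hNu⟩ := h (k + 1)
  have hk : (0 : ℝ) < (k : ℝ) + 1 := by positivity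
  have h₁ : ((k : ℝ) + 1) • u ≤ g := by
    refine le_trans ?_ hNu
    rw [← Nat.cast_smul_eq_nsmul ℝ]
    exact smul_le_smul_of_nonneg_right (by exact_mod_cast hN) hu
  calc u = (1 / ((k : ℝ) + 1)) • (((k : ℝ) + 1) • u) := by
        rw [smul_smul, one_div_mul_cancel hk.ne', one_smul]
    _ ≤ _ := smul_le_smul_of_nonneg_left h₁ (by positivity)

/-- If all shells of `x` are below `h`, then `(f - h)⁺` is disjoint from everything which `x`
eventually dominates geometrically. -/
theorem posPart_sub_inf_eq_zero [Module ℝ F] [IsOrderedModule ℝ F] (hF : IsArchimedean F)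
    {f h b : F} {x : ℕ → F} {m : ℕ} (hf : 0 ≤ f) (h0 : x 0 = 0)
    (hh : ∀ n, shell f (x n) (x (n + 1)) ≤ h) (hb : 0 ≤ b) (hx : ∀ n ≥ m, 3 ^ n • b ≤ x n) :
    (f - h)⁺ ⊓ b = 0 := by
  have hu : 0 ≤ (f - h)⁺ ⊓ b := le_inf (posPart_nonneg _) hb
  refine hF.eq_zero_of_nsmul_le hu (g := 2 • f) (nsmul_nonneg hf _) fun k =>
    ⟨3 ^ max k m, (le_max_left k m).trans (Nat.lt_pow_self (by norm_num)).le, ?_⟩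
  exact nsmul_le_of_posPart_sub_inf_le hf hu inf_le_left
    ((nsmul_le_nsmul_right inf_le_right _).trans (hx _ (le_max_right k m)))
    (posPart_sub_inf_le_of_shell_le hf h0 hh _)

theorem three_nsmul_le_of_lt {x : ℕ → F} (hx : ∀ n, 0 ≤ x n) (h3 : ∀ n, 3 • x n ≤ x (n + 1))
    {n m : ℕ} (h : n < m) : 3 • x n ≤ x m := by
  have hmono : Monotone x :=
    monotone_nat_of_le_succ fun n => (le_nsmul_self (hx n) three_ne_zero).trans (h3 n)
  exact (h3 n).trans (hmono h)

/-- Let `x i` be mutually disjoint, geometrically growing sequences. If disjoint order bounded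
sets of shells are order bounded in `H`, then all shells have a common upper bound in `H`. -/
theorem exists_shell_le [Module ℝ F] {ι : Type*} {H : Submodule ℝ F} (hH : IsIdeal H) {f : F}
    (hf : 0 ≤ f) {x : ι → ℕ → F} (hx : ∀ i n, 0 ≤ x i n) (h3 : ∀ i n, 3 • x i n ≤ x i (n + 1))
    (hdisj : ∀ i j, i ≠ j → ∀ n m, x i n ⊓ x j m = 0)
    (hbdd : ∀ s : ℕ → ℕ, IsDisjointSet
        (Set.range fun p : ι × ℕ => shell f (x p.1 (s p.2)) (x p.1 (s p.2 + 1))) →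
      OrderBoundedIn Set.univ
        (Set.range fun p : ι × ℕ => shell f (x p.1 (s p.2)) (x p.1 (s p.2 + 1))) →
      OrderBoundedIn (H : Set F)
        (Set.range fun p : ι × ℕ => shell f (x p.1 (s p.2)) (x p.1 (s p.2 + 1)))) :
    ∃ h ∈ H, ∀ i n, shell f (x i n) (x i (n + 1)) ≤ h := by
  have key : ∀ s : ℕ → ℕ, (∀ k l, k < l → s k + 1 < s l) →
      ∃ h ∈ H, 0 ≤ h ∧ ∀ i k, shell f (x i (s k)) (x i (s k + 1)) ≤ h := by
    intro s hs
    have hd : IsDisjointSet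
        (Set.range fun p : ι × ℕ => shell f (x p.1 (s p.2)) (x p.1 (s p.2 + 1))) := by
      rintro _ ⟨⟨i, k⟩, rfl⟩ _ ⟨⟨j, l⟩, rfl⟩ hne
      rw [disj_iff_of_nonneg (shell_nonneg hf) (shell_nonneg hf)]
      by_cases hij : i = j
      · subst hij
        rcases lt_trichotomy k l with hkl | rfl | hkl
        · exact shell_inf_shell hf (three_nsmul_le_of_lt (hx i) (h3 i) (hs _ _ hkl))
        · exact absurd rfl hne
        · rw [inf_comm]
          exact shell_inf_shell hf (three_nsmul_le_of_lt (hx i) (h3 i) (hs _ _ hkl))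
      · exact inf_eq_zero_of_le (shell_nonneg hf) (shell_nonneg hf)
          (shell_le_right hf (hx _ _)) (shell_le_right hf (hx _ _)) (hdisj i j hij _ _)
    obtain ⟨_, -, b, hb, hGb⟩ := hbdd s hd
      ⟨0, trivial, f, trivial, by rintro _ ⟨p, rfl⟩; exact ⟨shell_nonneg hf, shell_le_left⟩⟩
    exact ⟨|b|, hH.abs_mem hb, abs_nonneg b,
      fun i k => (hGb ⟨(i, k), rfl⟩).2.trans (le_abs_self b)⟩
  -- Consecutive shells may overlap, so even and odd indices are bounded separately.
  obtain ⟨a, ha, ha0, hae⟩ := key (fun k => 2 * k) fun k l h => by omega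
  obtain ⟨b, hb, hb0, hbo⟩ := key (fun k => 2 * k + 1) fun k l h => by omega
  refine ⟨a + b, H.add_mem ha hb, fun i n => ?_⟩
  rcases Nat.even_or_odd' n with ⟨k, rfl | rfl⟩
  · exact (hae i k).trans (le_add_of_nonneg_right hb0)
  · exact (hbo i k).trans (le_add_of_nonneg_left ha0)

/-! ### Projection bands and order bounds -/

theorem isProjectionBand_of_posPart_sub [Module ℝ F] [IsOrderedModule ℝ F] {E H : Submodule ℝ F}
    (hH : IsIdeal H) (hEH : IsOrderDenseIn E H)
    (h : ∀ f : F, 0 ≤ f → ∃ h ∈ H, ∀ e ∈ E, 0 ≤ e → (f - h)⁺ ⊓ e = 0) :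
    IsProjectionBand H := by
  have hpos : ∀ f : F, 0 ≤ f → ∃ a ∈ H, ∃ g ∈ disjointComplement (H : Set F), f = a + g := by
    intro f hf
    obtain ⟨a, ha, hd⟩ := h f hf
    -- The remainder lies below `(f - a)⁺`. If it met `H`, order density would put some `0 < e ∈ E`
    -- below it, disjoint from itself.
    refine ⟨f ⊓ |a|, hH.mem_of_le (le_inf hf (abs_nonneg a)) inf_le_right (hH.abs_mem ha),
      f - f ⊓ |a|, fun k hk => ?_, by abel⟩
    have h0 : 0 ≤ f - f ⊓ |a| := sub_nonneg.2 inf_le_left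
    have hle : f - f ⊓ |a| ≤ (f - a)⁺ := by
      rw [sub_inf, sub_self]
      exact sup_le (posPart_nonneg _) ((sub_le_sub_left (le_abs_self a) f).trans (le_posPart _))
    unfold Disj
    rw [abs_of_nonneg h0]
    have hw0 : 0 ≤ (f - f ⊓ |a|) ⊓ |k| := le_inf h0 (abs_nonneg k)
    by_contra hne
    obtain ⟨e, he, hepos, hew⟩ := hEH.2 _
      (hH.mem_of_le hw0 inf_le_right (hH.abs_mem hk)) (lt_of_le_of_ne hw0 (Ne.symm hne))
    refine hepos.ne' ?_
    rw [← hd e he hepos.le, eq_comm, inf_eq_right]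
    exact hew.trans (inf_le_left.trans hle)
  refine ⟨hH, fun f => ?_⟩
  obtain ⟨a, ha, g, hg, hag⟩ := hpos f⁺ (posPart_nonneg f)
  obtain ⟨b, hb, k, hk, hbk⟩ := hpos f⁻ (negPart_nonneg f)
  refine ⟨a - b, H.sub_mem ha hb, g - k, fun c hc => Disj.symm ?_, ?_⟩
  · exact (disjointSubmodule c).sub_mem (hg c hc).symm (hk c hc).symm
  · rw [← posPart_sub_negPart f, hag, hbk]; abel

theorem IsProjectionBand.orderBoundedIn [Module ℝ F] {H : Submodule ℝ F}
    (hH : IsProjectionBand H) {G : Set F} (hG : G ⊆ pos (H : Set F))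
    (hb : OrderBoundedIn Set.univ G) : OrderBoundedIn (H : Set F) G := by
  obtain ⟨_, -, b, -, hGb⟩ := hb
  obtain ⟨a, ha, g, hg, rfl⟩ := hH.2 b
  refine ⟨0, H.zero_mem, |a|, hH.1.abs_mem ha, fun x hx => ⟨(hG hx).2, ?_⟩⟩
  have hx0 : 0 ≤ x := (hG hx).2
  have hxg : x ⊓ |g| = 0 := by
    have := (hg x (hG hx).1).symm
    rwa [Disj, abs_of_nonneg hx0] at this
  calc x ≤ x ⊓ (|a| + |g|) :=
        le_inf le_rfl ((hGb hx).2.trans (add_le_add (le_abs_self a) (le_abs_self g)))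
    _ ≤ x ⊓ |a| + x ⊓ |g| := inf_add_le_of_nonneg hx0 (abs_nonneg a) (abs_nonneg g)
    _ ≤ |a| := by rw [hxg, add_zero]; exact inf_le_right

/-! ### Geometric sequences and the two criteria -/

theorem geomSeq_nonneg {b : ℕ → F} (hb : ∀ n, 0 ≤ b n) (n : ℕ) : 0 ≤ geomSeq b n := by
  unfold geomSeq; split_ifs
  · exact le_rfl
  · exact nsmul_nonneg (hb n) _

theorem three_nsmul_geomSeq_le {b : ℕ → F} (hb : ∀ n, 0 ≤ b n) (hmono : Monotone b) (n : ℕ) :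
    3 • geomSeq b n ≤ geomSeq b (n + 1) := by
  rcases eq_or_ne n 0 with rfl | hn
  · simpa [geomSeq] using nsmul_nonneg (hb 1) 3
  · rw [geomSeq, geomSeq, if_neg hn, if_neg n.succ_ne_zero, smul_smul, ← pow_succ']
    exact nsmul_le_nsmul_right (hmono n.le_succ) _

theorem nsmul_le_geomSeq {b : ℕ → F} (hmono : Monotone b) {n m : ℕ} (h : m + 1 ≤ n) :
    3 ^ n • b m ≤ geomSeq b n := by
  rw [geomSeq, if_neg (by omega)]
  exact nsmul_le_nsmul_right (hmono (by omega)) _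

theorem shell_geomSeq_mem [Module ℝ F] {E : Submodule ℝ F} (hE : IsIdeal E) {f : F} (hf : 0 ≤ f)
    {b : ℕ → F} (hb : ∀ n, b n ∈ E) (hb0 : ∀ n, 0 ≤ b n) (n m : ℕ) :
    shell f (geomSeq b n) (geomSeq b m) ∈ E :=
  hE.mem_of_le (shell_nonneg hf) (shell_le_right hf (geomSeq_nonneg hb0 m)) (geomSeq_mem hb m)

theorem exists_maximal_disjoint [Module ℝ F] (E : Submodule ℝ F) :
    ∃ M ⊆ pos (E : Set F), IsDisjointSet M ∧
      ∀ w ∈ pos (E : Set F), (∀ b ∈ M, w ⊓ b = 0) → w = 0 := by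
  obtain ⟨M, hM⟩ := zorn_subset {M : Set F | M ⊆ pos (E : Set F) ∧ IsDisjointSet M} (by
    refine fun c hc hchain => ⟨⋃₀ c, ⟨Set.sUnion_subset fun s hs => (hc hs).1, ?_⟩,
      fun s hs => Set.subset_sUnion_of_mem hs⟩
    exact (Set.pairwise_sUnion hchain.directedOn).2 fun s hs => (hc hs).2)
  refine ⟨M, hM.prop.1, hM.prop.2, fun w hw hd => ?_⟩
  have hins : insert w M ∈ {M : Set F | M ⊆ pos (E : Set F) ∧ IsDisjointSet M} := by
    refine ⟨Set.insert_subset hw hM.prop.1, hM.prop.2.insert fun b hb _ => ?_⟩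
    have : Disj w b := (disj_iff_of_nonneg hw.2 (hM.prop.1 hb).2).2 (hd b hb)
    exact ⟨this, this.symm⟩
  have hwM : w ∈ M := hM.le_of_ge hins (Set.subset_insert w M) (Set.mem_insert w M)
  simpa using hd w hwM

theorem isProjectionBand_of_disjoint [Module ℝ F] [IsOrderedModule ℝ F] (hF : IsArchimedean F)
    {E H : Submodule ℝ F} (hH : IsIdeal H) (hE : IsIdeal E) (hEH : IsOrderDenseIn E H)
    (hbdd : ∀ G : Set F, G ⊆ pos (E : Set F) → IsDisjointSet G →
      OrderBoundedIn Set.univ G → OrderBoundedIn (H : Set F) G) :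
    IsProjectionBand H := by
  refine isProjectionBand_of_posPart_sub hH hEH fun f hf => ?_
  obtain ⟨M, hME, hMd, hmax⟩ := exists_maximal_disjoint E
  have hM0 : ∀ b : M, 0 ≤ (b : F) := fun b => (hME b.2).2
  let x : M → ℕ → F := fun b => geomSeq fun _ => (b : F)
  have hle : ∀ (b : M) n, x b n ≤ 3 ^ n • (b : F) := fun b n => by
    simp only [x, geomSeq]; split_ifs
    · exact nsmul_nonneg (hM0 b) _
    · exact le_rfl
  obtain ⟨h, hh, hsh⟩ := exists_shell_le (x := x) hH hf
    (fun b => geomSeq_nonneg fun _ => hM0 b)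
    (fun b => three_nsmul_geomSeq_le (fun _ => hM0 b) monotone_const)
    (fun b c hbc n m => by
      have hd : (b : F) ⊓ c = 0 := (disj_iff_of_nonneg (hM0 b) (hM0 c)).1
        (hMd b.2 c.2 (Subtype.coe_ne_coe.2 hbc))
      refine inf_eq_zero_of_le (geomSeq_nonneg (fun _ => hM0 b) n)
        (geomSeq_nonneg (fun _ => hM0 c) m) (hle b n) (hle c m) ?_
      refine inf_nsmul_eq_zero (nsmul_nonneg (hM0 b) _) (hM0 c) ?_ _
      rw [inf_comm] at hd ⊢
      exact inf_nsmul_eq_zero (hM0 c) (hM0 b) hd _)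
    (fun s => hbdd _ (by
      rintro _ ⟨p, rfl⟩
      exact ⟨shell_geomSeq_mem hE hf (fun _ => (hME p.1.2).1) (fun _ => hM0 p.1) _ _,
        shell_nonneg hf⟩))
  refine ⟨h, hh, fun e he he0 => ?_⟩
  have hw0 : 0 ≤ (f - h)⁺ ⊓ e := le_inf (posPart_nonneg _) he0
  refine hmax _ ⟨hE.mem_of_le hw0 inf_le_right he, hw0⟩ fun b hb => ?_
  refine inf_eq_zero_of_le hw0 (hME hb).2 inf_le_left le_rfl ?_
  -- The geometric bound starts at index 1, since the sequence is `0` at index 0.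
  exact posPart_sub_inf_eq_zero hF hf (if_pos rfl) (hsh ⟨b, hb⟩) (hME hb).2
    (m := 0 + 1) fun n hn => nsmul_le_geomSeq (b := fun _ => b) monotone_const hn

theorem isProjectionBand_of_countable_disjoint [Module ℝ F] [IsOrderedModule ℝ F]
    (hF : IsArchimedean F) {E H : Submodule ℝ F} (hH : IsIdeal H) (hE : IsIdeal E)
    (hEc : IsCountablyGenerated E) (hEH : IsOrderDenseIn E H)
    (hbdd : ∀ G : Set F, G.Countable → G ⊆ pos (E : Set F) → IsDisjointSet G →
      OrderBoundedIn Set.univ G → OrderBoundedIn (H : Set F) G) :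
    IsProjectionBand H := by
  refine isProjectionBand_of_posPart_sub hH hEH fun f hf => ?_
  obtain ⟨A, hA, hEA⟩ := hEc
  -- Adjoining `0` allows an enumeration even when `A` is empty.
  obtain ⟨g, hg⟩ := (hA.insert 0).exists_eq_range (Set.insert_nonempty 0 A)
  have hAE : A ⊆ E := by
    rw [hEA]; exact fun a ha => (Submodule.mem_sInf).2 fun J hJ => hJ.2 ha
  have hgE : ∀ n, g n ∈ E := fun n => by
    have : g n ∈ insert 0 A := hg ▸ Set.mem_range_self n
    rcases this with h | h
    · rw [h]; exact E.zero_mem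
    · exact hAE h
  let b : ℕ → F := fun n => ∑ i ∈ Finset.range (n + 1), |g i|
  have hb0 : ∀ n, 0 ≤ b n := fun n => Finset.sum_nonneg fun i _ => abs_nonneg _
  have hbE : ∀ n, b n ∈ E := fun n => E.sum_mem fun i _ => hE.abs_mem (hgE i)
  have hmono : Monotone b := monotone_nat_of_le_succ fun n => by
    simp only [b]
    rw [Finset.sum_range_succ _ (n + 1)]
    exact le_add_of_nonneg_right (abs_nonneg _)
  obtain ⟨h, hh, hsh⟩ := exists_shell_le (ι := Unit) (x := fun _ => geomSeq b) hH hf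
    (fun _ => geomSeq_nonneg hb0) (fun _ => three_nsmul_geomSeq_le hb0 hmono)
    (fun i j hij => absurd (Subsingleton.elim i j) hij)
    (fun s => hbdd _ (Set.countable_range _) (by
      rintro _ ⟨p, rfl⟩
      exact ⟨shell_geomSeq_mem hE hf hbE hb0 _ _, shell_nonneg hf⟩))
  refine ⟨h, hh, fun e he he0 => ?_⟩
  -- The elements disjoint from `(f - h)⁺` form an ideal, so generators suffice.
  have hle : E ≤ disjointSubmodule (f - h)⁺ := by
    rw [hEA]
    refine sInf_le ⟨isIdeal_disjointSubmodule _, fun a ha => ?_⟩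
    obtain ⟨m, rfl⟩ : a ∈ Set.range g := hg ▸ Set.mem_insert_of_mem 0 ha
    have hgb : |g m| ≤ b m :=
      Finset.single_le_sum (f := fun i => |g i|) (fun i _ => abs_nonneg _)
        (Finset.self_mem_range_succ m)
    refine inf_eq_zero_of_le (abs_nonneg _) (abs_nonneg _) (abs_of_nonneg (posPart_nonneg _)).le
      hgb ?_
    exact posPart_sub_inf_eq_zero hF hf (if_pos rfl) (hsh ()) (hb0 m)
      (m := m + 1) fun n hn => nsmul_le_geomSeq hmono hn
  exact (disj_iff_of_nonneg (posPart_nonneg _) he0).1 (hle he)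

end Lemmas
end VectorLattice

theorem theorem3p10 {F : Type*} [AddCommGroup F] [Lattice F] [IsOrderedAddMonoid F]
    [Module ℝ F] [IsOrderedModule ℝ F] (hF : VectorLattice.IsArchimedean F)
    (H : Submodule ℝ F) (hH : VectorLattice.IsIdeal H) :
    List.TFAE [
      VectorLattice.IsProjectionBand H,
      ∀ G : Set F, G ⊆ VectorLattice.pos (H : Set F) →
        VectorLattice.OrderBoundedIn Set.univ G → VectorLattice.OrderBoundedIn (H : Set F) G,
      ∀ G : Set F, G ⊆ VectorLattice.pos (H : Set F) → VectorLattice.IsDisjointSet G →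
        VectorLattice.OrderBoundedIn Set.univ G → VectorLattice.OrderBoundedIn (H : Set F) G,
      ∃ E : Submodule ℝ F, VectorLattice.IsIdeal E ∧ VectorLattice.IsOrderDenseIn E H ∧
        ∀ G : Set F, G ⊆ VectorLattice.pos (E : Set F) → VectorLattice.IsDisjointSet G →
          VectorLattice.OrderBoundedIn Set.univ G →
          VectorLattice.OrderBoundedIn (H : Set F) G] ∧
    ((∃ E : Submodule ℝ F, VectorLattice.IsIdeal E ∧ VectorLattice.IsCountablyGenerated E ∧
        VectorLattice.IsOrderDenseIn E H ∧
        ∀ G : Set F, G.Countable → G ⊆ VectorLattice.pos (E : Set F) →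
          VectorLattice.IsDisjointSet G → VectorLattice.OrderBoundedIn Set.univ G →
          VectorLattice.OrderBoundedIn (H : Set F) G) →
      VectorLattice.IsProjectionBand H) := by
  refine ⟨?_, fun ⟨E, hE, hEc, hEH, hbdd⟩ =>
    VectorLattice.isProjectionBand_of_countable_disjoint hF hH hE hEc hEH hbdd⟩
  tfae_have 1 → 2 := fun h G hG => h.orderBoundedIn hG
  tfae_have 2 → 3 := fun h G hG _ => h G hG
  tfae_have 3 → 4 := fun h => ⟨H, hH, ⟨le_rfl, fun a ha ha0 => ⟨a, ha, ha0, le_rfl⟩⟩, h⟩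
  tfae_have 4 → 1 := fun ⟨E, hE, hEH, hbdd⟩ =>
    VectorLattice.isProjectionBand_of_disjoint hF hH hE hEH hbdd
  tfae_finish
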